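/- Let $Q=(q_{ij})_{i,j\ge 0}$ be the generator of a skip-free process on $\{0,1,2,\dots\}$: $q_{ij}\ge 0$ for $i\ne j$, $q_{i,i+1}>0$, $q_{ij}=0$ for $j>i+1$, and $\sum_{j=0}^{i+1}q_{ij}=0$ for all $i\ge 0$. Let $\{X_t\}_{t\ge 0}$ be a Markov process with generator $Q$ started at $0$, described by its jump chain and holding times: the successive states $Y_0=0,Y_1,Y_2,\dots$ form a Markov chain with transition probabilities $p_{xy}=-q_{xy}/q_{xx}$ for $x\ne y$ and $p_{xx}=0$; given $\{Y_k\}_{k\ge 0}$, the holding times are independent, the $k$-th one being exponential with rate $-q_{Y_kY_k}$. (The values of $X$ after a possible explosion are irrelevant.) For $n\ge 0$ let $T_n=\inf\{t\ge 0: X_t=n\}$, let $l_{T_n}^i=\int_0^{T_n}1_{\{X_s=i\}}\,ds$ for $0\le i\le n-1$ be the occupation time of state $i$ before $T_n$, and let $Q_n=(q_{ij})_{0\le i,j\le n-1}$. If $Q_n$ is tridiagonal, that is, $q_{ij}=0$ whenever $0\le i,j\le n-1$ and $|i-j|>1$, then $\{l_{T_n}^i\}_{0\le i\le n-1}$ has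 the Markov property: for every $1\le k\le n-1$, the conditional distribution of $l_{T_n}^k$ given $(l_{T_n}^{k-1},l_{T_n}^{k-2},\dots,l_{T_n}^0)$ is almost surely equal to its conditional distribution given $l_{T_n}^{k-1}$. -/

import Mathlib

open MeasureTheory ProbabilityTheory
open scoped NNReal ENNReal

/-- `Q = (q_{ij})` is the generator of a skip-free process on `{0, 1, 2, …}`: off-diagonal entries
are non-negative, `q_{i,i+1} > 0`, `q_{ij} = 0` for `j > i + 1`, and every row sums to zero. In
particular `q_{ii} < 0` for every `i`, so there are no absorbing states. -/
structure IsSkipFreeGenerator (Q : Matrix ℕ ℕ ℝ) : Prop where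
  nonneg : ∀ i j, i ≠ j → 0 ≤ Q i j
  up_pos : ∀ i, 0 < Q i (i + 1)
  skip_free : ∀ i j, i + 1 < j → Q i j = 0
  row_sum : ∀ i, ∑ j ∈ Finset.range (i + 2), Q i j = 0

/-- The upper left `n × n` submatrix `Q_n` of `Q`. -/
def upperLeft (Q : Matrix ℕ ℕ ℝ) (n : ℕ) : Matrix (Fin n) (Fin n) ℝ :=
  Q.submatrix Fin.val Fin.val

/-- All entries off the main diagonal and the two adjacent diagonals vanish. -/
def IsTridiagonal {n : ℕ} (M : Matrix (Fin n) (Fin n) ℝ) : Prop :=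
  ∀ i j : Fin n, (i : ℕ) + 1 < j ∨ (j : ℕ) + 1 < i → M i j = 0

/-- One-step transition probabilities of the embedded chain: `p_{xy} = -q_{xy} / q_{xx}` for
`x ≠ y`, and `p_{xx} = 0`. -/
noncomputable def jumpProb (Q : Matrix ℕ ℕ ℝ) (x y : ℕ) : ℝ :=
  if x = y then 0 else -Q x y / Q x x

/-- `X` is a Markov process on `{0, 1, 2, …}` with generator `Q` (without absorbing states),
started at `x₀`, in the jump chain / holding time description. There are random variables `Y k`
(successive states) and `W k` (holding times) such that `Y` is a discrete time Markov chain started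
at `x₀` with transition probabilities `jumpProb Q`, conditionally on `Y` the `W k` are independent
and exponential with rates `-q_{Y_k Y_k}`, and almost surely `X` is equal to `Y k` on
`[S k, S (k + 1))`, where `S k = W 0 + ⋯ + W (k - 1)` is the time of the `k`-th transition. The
values of `X` after the explosion time `sup S k`, if it is finite, are unrestricted. -/
def IsMarkovJumpProcess {Ω : Type*} [MeasurableSpace Ω] (P : Measure Ω)
    (Q : Matrix ℕ ℕ ℝ) (x₀ : ℕ) (X : ℝ≥0 → Ω → ℕ) : Prop :=
  (∀ t, Measurable (X t)) ∧
  ∃ (Y : ℕ → Ω → ℕ) (W : ℕ → Ω → ℝ),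
    (∀ k, Measurable (Y k)) ∧ (∀ k, Measurable (W k)) ∧
    (∀ (k : ℕ) (y : ℕ → ℕ) (B : ℕ → Set ℝ), (∀ i, MeasurableSet (B i)) →
      P {ω | ∀ i ≤ k, Y i ω = y i ∧ W i ω ∈ B i} =
        (if y 0 = x₀ then 1 else 0) *
          (∏ i ∈ Finset.range k, ENNReal.ofReal (jumpProb Q (y i) (y (i + 1)))) *
          ∏ i ∈ Finset.range (k + 1), expMeasure (-Q (y i) (y i)) (B i)) ∧
    ∀ᵐ ω ∂P, ∀ (k : ℕ) (t : ℝ≥0),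
      ∑ i ∈ Finset.range k, W i ω ≤ t → t < ∑ i ∈ Finset.range (k + 1), W i ω → X t ω = Y k ω

/-- `T_n`: the first time at which the path is in state `n` (`∞` if there is none). -/
noncomputable def firstHit {Ω : Type*} (X : ℝ≥0 → Ω → ℕ) (n : ℕ) (ω : Ω) : ℝ≥0∞ :=
  ⨅ (t : ℝ≥0) (_ : X t ω = n), (t : ℝ≥0∞)

/-- `l_{T_n}^i`: the amount of time spent in state `i` before the first hit of `n`, that is,
`∫_0^{T_n} 1_{X_s = i} ds`. -/
noncomputable def occupationTime {Ω : Type*} (X : ℝ≥0 → Ω → ℕ) (n i : ℕ) (ω : Ω) : ℝ≥0∞ :=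
  ∫⁻ s in {s : ℝ | 0 ≤ s ∧ ENNReal.ofReal s < firstHit X n ω},
    {s : ℝ | X s.toNNReal ω = i}.indicator 1 s

/-- The finite sequence `Z 0, …, Z (n - 1)` of random variables has the Markov property: for
`1 ≤ k ≤ n - 1` the conditional law of `Z k` given `(Z 0, …, Z (k - 1))` is almost surely equal to
the conditional law of `Z k` given `Z (k - 1)`. -/
def HasMarkovProperty {Ω E : Type*} [MeasurableSpace Ω] [MeasurableSpace E]
    [StandardBorelSpace E] [Nonempty E] (P : Measure Ω) [IsFiniteMeasure P]
    (n : ℕ) (Z : ℕ → Ω → E) : Prop :=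
  (∀ i < n, AEMeasurable (Z i) P) ∧
  ∀ k, 1 ≤ k → k < n → ∀ᵐ ω ∂P,
    condDistrib (Z k) (fun ω' (j : Fin k) => Z j ω') P (fun j : Fin k => Z j ω) =
      condDistrib (Z k) (Z (k - 1)) P (Z (k - 1) ω)

/-! Let b, d be the up and down rates and l_i the occupation time of i. First-step analysis shows
that the joint Laplace transform of the l_i with exponents a_i ≥ 0 is φ(0), where φ(n) = 1 and (b_i
+ d_i + a_i) φ(i) = b_i φ(i+1) + d_i φ(i-1) for i < n (`hitTransform_toReal_eq`,
`HasJumpHoldLaw.lintegral_exp_visitTime`).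

Suppose a vanishes above N + 1 and a_{N+1} = r. The levels above N + 1 then enter only through an
effective rate β from N + 1 to n (`exists_effective_up_rate`), and φ(N+1) can be eliminated. The
reduced systems on {0, …, N} for the exponents (a_0, …, a_N, r) and (a_0, …, a_N + γ(r), 0) coincide
up to a factor δ(r) on the solutions (`exists_laplace_reduction`). Hence E[e^{-r l_{N+1}} ∏ e^{-a_i
l_i}] = δ(r) E[e^{-γ(r) l_N} ∏ e^{-a_i l_i}], the products being over i ≤ N: given l_0, …, l_N, the
variable l_{N+1} has Laplace transform δ(r) e^{-γ(r) l_N}, a function of l_N alone.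

Integer exponents suffice, because polynomials in the e^{-x_i} separate the points of the compact
space [0, ∞]^ι (`map_eq_of_lintegral_prod_negExp_pow`, `condDistrib_ae_eq_condDistrib_comp`). Almost
surely the jump chain reaches n after finitely many steps (`HasJumpHoldLaw.ae_exists_hitsAt`), so
explosion plays no role. -/

/-! ### Laplace transforms and conditional laws on [0, ∞]. -/

/-- The decreasing homeomorphism `x ↦ e^{-x}` from `[0, ∞]` onto `[0, 1]`. -/
noncomputable def negExp (x : ℝ≥0∞) : ℝ≥0∞ := EReal.exp (-(x : EReal))

lemma negExp_le_one (x : ℝ≥0∞) : negExp x ≤ 1 := by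
  rw [negExp, EReal.exp_le_one_iff, EReal.neg_le, neg_zero]
  exact EReal.coe_ennreal_nonneg x

lemma continuous_negExp : Continuous negExp :=
  ENNReal.continuous_exp.comp (continuous_neg.comp continuous_coe_ennreal_ereal)

@[fun_prop]
lemma measurable_negExp : Measurable negExp := continuous_negExp.measurable

lemma negExp_injective : Function.Injective negExp := fun x y h => by
  have := EReal.exp_strictMono.injective h
  simpa using this

lemma negExp_ofReal {t : ℝ} (ht : 0 ≤ t) :
    negExp (ENNReal.ofReal t) = ENNReal.ofReal (Real.exp (-t)) := by
  rw [negExp, EReal.coe_ennreal_ofReal, max_eq_left ht, ← EReal.coe_neg, EReal.exp_coe]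

/-- A finite measure on `[0, ∞]^ι` is determined by its Laplace transform at integer points. -/
theorem map_eq_of_lintegral_prod_negExp_pow {ι α : Type*} [Fintype ι] [MeasurableSpace α]
    {μ ν : Measure α} [IsFiniteMeasure μ] [IsFiniteMeasure ν] {f : α → ι → ℝ≥0∞}
    (hf : Measurable f)
    (h : ∀ m : ι → ℕ, ∫⁻ x, ∏ i, negExp (f x i) ^ m i ∂μ = ∫⁻ x, ∏ i, negExp (f x i) ^ m i ∂ν) :
    μ.map f = ν.map f := by
  let u (i : ι) : BoundedContinuousFunction (ι → ℝ≥0∞) ℝ :=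
    BoundedContinuousFunction.mkOfCompact ⟨fun x => (negExp (x i)).toReal,
      ENNReal.continuousOn_toReal.comp_continuous
        (continuous_negExp.comp (continuous_apply i))
        fun x => ((negExp_le_one _).trans_lt ENNReal.one_lt_top).ne⟩
  have hu (i x) : u i x = (negExp (x i)).toReal := rfl
  -- Polynomials in the coordinates e^{-x_i}: a point-separating algebra whose monomials are the
  -- integrands in `h`.
  let A : StarSubalgebra ℝ (BoundedContinuousFunction (ι → ℝ≥0∞) ℝ) :=
    { (MvPolynomial.aeval (R := ℝ) u).range with
      star_mem' := fun {a} ha => by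
        have : star a = a := by ext x; simp
        rwa [this] }
  refine ext_of_forall_mem_subalgebra_integral_eq_of_polish (𝕜 := ℝ) (A := A) ?_ ?_
  · intro x y hxy
    obtain ⟨i, hi⟩ := Function.ne_iff.mp hxy
    refine ⟨u i, ⟨(u i).toContinuousMap, ⟨u i, ⟨MvPolynomial.X i, by simp⟩, rfl⟩, rfl⟩, ?_⟩
    rw [hu, hu, Ne, ENNReal.toReal_eq_toReal_iff'
      ((negExp_le_one _).trans_lt ENNReal.one_lt_top).ne
      ((negExp_le_one _).trans_lt ENNReal.one_lt_top).ne]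
    exact fun e => hi (negExp_injective e)
  · rintro g ⟨p, rfl⟩
    change ∫ x, (MvPolynomial.aeval u p) x ∂_ = ∫ x, (MvPolynomial.aeval u p) x ∂_
    induction p using MvPolynomial.induction_on' with
    | monomial m c =>
      have key (x : ι → ℝ≥0∞) : (MvPolynomial.aeval u (MvPolynomial.monomial m c)) x =
          c * (∏ i, negExp (x i) ^ m i).toReal := by
        rw [MvPolynomial.aeval_monomial, Finsupp.prod_fintype _ _ (by simp)]
        simp [ENNReal.toReal_prod, hu, Algebra.algebraMap_eq_smul_one]
      have hm : Measurable fun x : ι → ℝ≥0∞ => ∏ i, negExp (x i) ^ m i := by fun_prop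
      have hle (x : ι → ℝ≥0∞) : ∏ i, negExp (x i) ^ m i < ∞ :=
        (Finset.prod_le_one' fun i _ => pow_le_one' (negExp_le_one _) _).trans_lt
          ENNReal.one_lt_top
      simp_rw [key, integral_const_mul]
      rw [integral_toReal hm.aemeasurable (.of_forall hle),
        integral_toReal hm.aemeasurable (.of_forall hle),
        lintegral_map hm hf, lintegral_map hm hf, h]
    | add p q hp hq =>
      simp only [map_add, BoundedContinuousFunction.coe_add, Pi.add_apply]
      rw [integral_add (BoundedContinuousFunction.integrable _ _)
        (BoundedContinuousFunction.integrable _ _),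
        integral_add (BoundedContinuousFunction.integrable _ _)
        (BoundedContinuousFunction.integrable _ _), hp, hq]

/-- A finite measure on `[0, ∞]` is determined by the moments of `negExp`. -/
theorem ext_of_lintegral_negExp_pow {μ ν : Measure ℝ≥0∞} [IsFiniteMeasure μ] [IsFiniteMeasure ν]
    (h : ∀ m : ℕ, ∫⁻ x, negExp x ^ m ∂μ = ∫⁻ x, negExp x ^ m ∂ν) : μ = ν := by
  have hf : Measurable fun (x : ℝ≥0∞) (_ : Unit) => x := by fun_prop
  have := map_eq_of_lintegral_prod_negExp_pow (μ := μ) (ν := ν) hf fun m => by simpa using h (m ())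
  have := congrArg (Measure.map fun x : Unit → ℝ≥0∞ => x ()) this
  rw [Measure.map_map (by fun_prop) hf, Measure.map_map (by fun_prop) hf] at this
  simpa [Function.comp_def] using this

/-- `H` is the defining relation of a conditional expectation; uniqueness of densities with respect
to the law of `V` does the rest. -/
lemma lintegral_condDistrib_ae_eq {Ω β E : Type*} [MeasurableSpace Ω] [MeasurableSpace β]
    [MeasurableSpace E] [StandardBorelSpace E] [Nonempty E] {P : Measure Ω} [IsFiniteMeasure P]
    {V : Ω → β} {Z : Ω → E} (hV : Measurable V) (hZ : Measurable Z) {h : E → ℝ≥0∞}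
    (hh : Measurable h) {g : β → ℝ≥0∞} (hg : Measurable g)
    (H : ∀ A, MeasurableSet A → ∫⁻ ω in V ⁻¹' A, h (Z ω) ∂P = ∫⁻ ω in V ⁻¹' A, g (V ω) ∂P) :
    ∀ᵐ ω ∂P, ∫⁻ y, h y ∂condDistrib Z V P (V ω) = g (V ω) := by
  have : (fun b => ∫⁻ y, h y ∂condDistrib Z V P b) =ᵐ[P.map V] g := by
    refine ae_eq_of_forall_setLIntegral_eq_of_sigmaFinite hh.lintegral_kernel hg fun A hA _ => ?_
    rw [setLIntegral_map hA hg hV, ← H A hA]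
    have h1 := setLIntegral_map (μ := P) (hA.prod MeasurableSet.univ)
      (hh.comp (measurable_snd (α := β))) (hV.prodMk hZ)
    rw [← compProd_map_condDistrib hZ.aemeasurable,
      Measure.setLIntegral_compProd (hh.comp measurable_snd) hA MeasurableSet.univ] at h1
    simpa [Set.mk_preimage_prod] using h1
  exact ae_of_ae_map hV.aemeasurable this

/-- If all the integer Laplace moments of `Z` given `V` are functions of `p V`, then conditioning
`Z` on `V` is the same as conditioning it on `p V`. -/
theorem condDistrib_ae_eq_condDistrib_comp {Ω ι : Type*} [Fintype ι]
    [MeasurableSpace Ω] {P : Measure Ω} [IsFiniteMeasure P] {V : Ω → ι → ℝ≥0∞} {Z : Ω → ℝ≥0∞}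
    (hV : Measurable V) (hZ : Measurable Z) (i₀ : ι) {ψ : ℕ → ℝ≥0∞ → ℝ≥0∞}
    (hψ : ∀ r, Measurable (ψ r)) (hψ1 : ∀ r x, ψ r x ≤ 1)
    (H : ∀ (r : ℕ) (m : ι → ℕ), ∫⁻ ω, negExp (Z ω) ^ r * ∏ i, negExp (V ω i) ^ m i ∂P =
      ∫⁻ ω, ψ r (V ω i₀) * ∏ i, negExp (V ω i) ^ m i ∂P) :
    ∀ᵐ ω ∂P, condDistrib Z V P (V ω) =
      condDistrib Z (fun ω => V ω i₀) P (V ω i₀) := by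
  -- `H` says that two weighted measures have the same Laplace transform along `V`; they therefore
  -- agree on all events of the σ-algebra generated by `V`.
  have hset (r : ℕ) (A : Set (ι → ℝ≥0∞)) (hA : MeasurableSet A) :
      ∫⁻ ω in V ⁻¹' A, negExp (Z ω) ^ r ∂P = ∫⁻ ω in V ⁻¹' A, ψ r (V ω i₀) ∂P := by
    have hm1 : Measurable fun ω => negExp (Z ω) ^ r := by fun_prop
    have hm2 : Measurable fun ω => ψ r (V ω i₀) := by fun_prop
    have bd (F : Ω → ℝ≥0∞) (hF : ∀ ω, F ω ≤ 1) : ∫⁻ ω, F ω ∂P ≠ ∞ :=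
      ((lintegral_mono hF).trans_lt (by simp)).ne
    have := isFiniteMeasure_withDensity
      (bd (fun ω => negExp (Z ω) ^ r) fun ω => pow_le_one' (negExp_le_one _) _)
    have := isFiniteMeasure_withDensity (bd (fun ω => ψ r (V ω i₀)) fun ω => hψ1 _ _)
    have := map_eq_of_lintegral_prod_negExp_pow (μ := P.withDensity fun ω => negExp (Z ω) ^ r)
      (ν := P.withDensity fun ω => ψ r (V ω i₀)) hV fun m => by
        rw [lintegral_withDensity_eq_lintegral_mul _ hm1 (by fun_prop),
          lintegral_withDensity_eq_lintegral_mul _ hm2 (by fun_prop)]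
        exact H r m
    have := congrArg (fun μ => μ A) this
    simpa only [Measure.map_apply hV hA, withDensity_apply _ (hV hA)] using this
  have h1 : ∀ᵐ ω ∂P, ∀ r, ∫⁻ y, negExp y ^ r ∂condDistrib Z V P (V ω) = ψ r (V ω i₀) :=
    ae_all_iff.2 fun r => lintegral_condDistrib_ae_eq hV hZ (h := fun y => negExp y ^ r)
      (by fun_prop) (g := fun v => ψ r (v i₀)) (by fun_prop) (hset r)
  have h2 : ∀ᵐ ω ∂P, ∀ r,
      ∫⁻ y, negExp y ^ r ∂condDistrib Z (fun ω => V ω i₀) P (V ω i₀) = ψ r (V ω i₀) :=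
    ae_all_iff.2 fun r => lintegral_condDistrib_ae_eq (V := fun ω => V ω i₀) (by fun_prop) hZ
      (h := fun y => negExp y ^ r) (by fun_prop) (hψ r)
      fun A hA => hset r ((fun v => v i₀) ⁻¹' A) (measurable_pi_apply i₀ hA)
  filter_upwards [h1, h2] with ω h1 h2
  exact ext_of_lintegral_negExp_pow fun r => (h1 r).trans (h2 r).symm

/-! ### Tridiagonal systems and elimination of the upper levels. -/

/-- Two solutions of the same tridiagonal linear system on `{0, …, N}` whose only inhomogeneity is
in the last row agree at `0`. -/
lemma tridiagonal_solution_unique {b d A f g : ℕ → ℝ} {N : ℕ} {c : ℝ} (hc : c ≠ 0)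
    (hb : ∀ i < N, b i ≠ 0)
    (hf : ∀ i < N, A i * f i = b i * f (i + 1) + d i * f (i - 1))
    (hg : ∀ i < N, A i * g i = b i * g (i + 1) + d i * g (i - 1))
    (hfN : A N * f N = c + d N * f (N - 1)) (hgN : A N * g N = c + d N * g (N - 1)) :
    f 0 = g 0 := by
  -- The rows below `N` are homogeneous and determine a solution up to a scalar from its value at 0;
  -- the last row then fixes the scalar, as `c ≠ 0`.
  have key : ∀ i ≤ N, f i * g 0 = g i * f 0 := by
    intro i
    induction i using Nat.strong_induction_on with
    | _ i ih =>
      intro hi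
      rcases i with _ | i
      · ring
      · have h1 := ih i (by omega) (by omega)
        have h2 : d i * (f (i - 1) * g 0) = d i * (g (i - 1) * f 0) := by
          rw [ih (i - 1) (by omega) (by omega)]
        apply mul_left_cancel₀ (hb i (by omega))
        linear_combination (A i) * h1 - h2 - g 0 * hf i (by omega) + f 0 * hg i (by omega)
  have h1 := key N le_rfl
  have h2 : d N * (f (N - 1) * g 0) = d N * (g (N - 1) * f 0) := by
    rw [key (N - 1) (by omega)]
  apply mul_left_cancel₀ hc
  linear_combination (-A N) * h1 + h2 + g 0 * hfN - f 0 * hgN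

/-- For a birth and death chain on `{0, …, n}` with birth rates `b` and death rates `d`, a function
that is harmonic on `{k + 1, …, n - 1}` and equal to `1` at `n` satisfies a boundary condition at
`k` with a positive rate `β` that does not depend on the function. -/
lemma exists_effective_up_rate {b d : ℕ → ℝ} (hb : ∀ i, 0 < b i) (hd : ∀ i, 0 ≤ d i) {n k : ℕ}
    (hk : k < n) :
    ∃ β : ℝ, 0 < β ∧ ∀ h : ℕ → ℝ, h n = 1 →
      (∀ i, k < i → i < n → (b i + d i) * h i = b i * h (i + 1) + d i * h (i - 1)) →
      b k * (h (k + 1) - h k) = β * (1 - h k) := by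
  obtain ⟨j, rfl⟩ : ∃ j, n = k + 1 + j := ⟨n - (k + 1), by omega⟩
  clear hk
  induction j generalizing k with
  | zero => exact ⟨b k, hb k, fun h h1 _ => by rw [show k + 1 = k + 1 + 0 from rfl, h1]⟩
  | succ j ih =>
    obtain ⟨β, hβ, H⟩ := ih (k := k + 1)
    have hpos : 0 < β + d (k + 1) := add_pos_of_pos_of_nonneg hβ (hd _)
    -- By `e1` and `e2`, h(k+1) is the average of 1 and h(k) with weights β and d(k+1).
    refine ⟨b k * β / (β + d (k + 1)), div_pos (mul_pos (hb k) hβ) hpos, fun h h1 h2 => ?_⟩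
    have e1 := H h (by rw [← h1]; congr 1; omega) fun i hi hi' => h2 i (by omega) (by omega)
    have e2 := h2 (k + 1) (by omega) (by omega)
    rw [Nat.add_sub_cancel] at e2
    field_simp
    linear_combination b k * (e1 + e2)

/-- The Laplace transform of the occupation times up to level `N + 1` is, up to a constant, the one
up to level `N` with a modified last argument. -/
lemma exists_laplace_reduction {b d : ℕ → ℝ} (hb : ∀ i, 0 < b i) (hd : ∀ i, 0 ≤ d i)
    {n N : ℕ} (hN : N + 1 < n) :
    ∃ γ δ : ℝ → ℝ, (∀ r, 0 ≤ r → 0 ≤ γ r ∧ 0 ≤ δ r ∧ δ r ≤ 1) ∧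
      ∀ a φ φ' : ℕ → ℝ, 0 ≤ a (N + 1) → (∀ i, N + 1 < i → a i = 0) → φ n = 1 → φ' n = 1 →
      (∀ i < n, (b i + d i + a i) * φ i = b i * φ (i + 1) + d i * φ (i - 1)) →
      (∀ i < n, (b i + d i + (if i < N then a i else if i = N then a N + γ (a (N + 1)) else 0)) *
        φ' i = b i * φ' (i + 1) + d i * φ' (i - 1)) →
      φ 0 = δ (a (N + 1)) * φ' 0 := by
  obtain ⟨β, hβ, H⟩ := exists_effective_up_rate hb hd hN
  set θ := β + d (N + 1) with hθ
  have hθpos : 0 < θ := add_pos_of_pos_of_nonneg hβ (hd _)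
  -- γ(r) = b_N d_{N+1} (1/θ - 1/(θ + r)) is the change in the diagonal entry of row N when level N
  -- + 1 is eliminated with exponent 0 instead of r.
  refine ⟨fun r => b N * d (N + 1) * r / (θ * (θ + r)), fun r => θ / (θ + r), fun r hr => ?_, ?_⟩
  · have h1 := (hb N).le
    have h2 := hd (N + 1)
    refine ⟨by positivity, by positivity, ?_⟩
    rw [div_le_one (by positivity)]
    linarith
  intro a φ φ' ha ha0 h1 h1' hφ hφ'
  have hθa : 0 < θ + a (N + 1) := by positivity
  have e1 := H φ h1 fun i hi hi' => by
    have := hφ i hi'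
    rwa [ha0 i hi, add_zero] at this
  have e1' := H φ' h1' fun i hi hi' => by
    have := hφ' i hi'
    rwa [if_neg (by omega), if_neg (by omega), add_zero] at this
  have e2 := hφ (N + 1) hN
  have e2' := hφ' (N + 1) hN
  rw [if_neg (by omega), if_neg (by omega)] at e2'
  rw [Nat.add_sub_cancel] at e2 e2'
  have e3 := hφ N (by omega)
  have e3' := hφ' N (by omega)
  rw [if_neg (lt_irrefl _), if_pos rfl] at e3'
  have f1 : (θ + a (N + 1)) * φ (N + 1) = β + d (N + 1) * φ N := by
    rw [hθ]; linear_combination e2 + e1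
  have f1' : θ * φ' (N + 1) = β + d (N + 1) * φ' N := by
    rw [hθ]; linear_combination e2' + e1'
  -- Scaling φ by θ + a(N+1) and φ' by θ gives both reduced systems the same inhomogeneity b_N β; by
  -- the choice of γ they also share the diagonal `A`.
  have key := tridiagonal_solution_unique (b := b) (d := d) (N := N) (c := b N * β)
    (f := fun i => (θ + a (N + 1)) * φ i) (g := fun i => θ * φ' i)
    (A := fun i => b i + d i + a i - if i = N then b N * d (N + 1) / (θ + a (N + 1)) else 0)
    (mul_pos (hb N) hβ).ne' (fun i _ => (hb i).ne')
    (fun i hi => by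
      have := hφ i (by omega)
      simp only [if_neg hi.ne]
      linear_combination (θ + a (N + 1)) * this)
    (fun i hi => by
      have := hφ' i (by omega)
      rw [if_pos hi] at this
      simp only [if_neg hi.ne]
      linear_combination θ * this)
    (by
      simp only [if_true]
      field_simp
      linear_combination (θ + a (N + 1)) * e3 + b N * f1)
    (by
      simp only [if_true]
      field_simp at e3' ⊢
      linear_combination e3' + b N * (θ + a (N + 1)) * f1')
  field_simp
  linear_combination key

/-! ### Integration against product and exponential laws. -/

lemma lintegral_eq_tsum_fiber {α ι : Type*} [MeasurableSpace α] [MeasurableSpace ι] [Countable ι]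
    [MeasurableSingletonClass ι] (μ : Measure α) {p : α → ι} (hp : Measurable p) (F : α → ℝ≥0∞) :
    ∫⁻ x, F x ∂μ = ∑' i, ∫⁻ x in p ⁻¹' {i}, F x ∂μ := by
  rw [← lintegral_iUnion (fun i => hp (measurableSet_singleton i))
    (fun i j hij => (Set.disjoint_singleton.2 hij).preimage p), ← Set.preimage_iUnion,
    Set.iUnion_of_singleton, Set.preimage_univ, setLIntegral_univ]

/-- Boxes determine the law of `W` as `c` times a product measure. The constant is needed because μ
will be P restricted to a path of the jump chain, with `c` the probability of that path. -/
lemma lintegral_prod_eq_of_map_pi {α ι : Type*} [Fintype ι] [MeasurableSpace α]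
    {μ : Measure α} {W : α → ι → ℝ} (hW : Measurable W) {ν : ι → Measure ℝ}
    [∀ i, IsProbabilityMeasure (ν i)] {c : ℝ≥0∞} (hc : c ≠ ∞)
    (h : ∀ B : ι → Set ℝ, (∀ i, MeasurableSet (B i)) →
      μ {x | ∀ i, W x i ∈ B i} = c * ∏ i, ν i (B i))
    (s : Finset ι) {g : ι → ℝ → ℝ≥0∞} (hg : ∀ i, Measurable (g i)) :
    ∫⁻ x, ∏ i ∈ s, g i (W x i) ∂μ = c * ∏ i ∈ s, ∫⁻ t, g i t ∂ν i := by
  have hmap : μ.map W = c • Measure.pi ν := by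
    have hpre (B : ι → Set ℝ) : W ⁻¹' Set.univ.pi B = {x | ∀ i, W x i ∈ B i} := by ext; simp
    rcases eq_or_ne c 0 with rfl | hc0
    · have := h (fun _ => Set.univ) fun _ => MeasurableSet.univ
      simp only [zero_mul, Set.mem_univ, implies_true, Set.ofPred_true] at this
      rw [Measure.measure_univ_eq_zero.1 this]
      simp
    · have : Measure.pi ν = c⁻¹ • μ.map W := Measure.pi_eq fun B hB => by
        rw [Measure.smul_apply, Measure.map_apply hW (.univ_pi hB), hpre, h B hB, smul_eq_mul,
          ← mul_assoc, ENNReal.inv_mul_cancel hc0 hc, one_mul]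
      rw [this, smul_smul, ENNReal.mul_inv_cancel hc0 hc, one_smul]
  have hm (i : ι) : Measurable fun x : ι → ℝ => g i (x i) := (hg i).comp (measurable_pi_apply i)
  rw [← lintegral_map (f := fun x : ι → ℝ => ∏ i ∈ s, g i (x i))
    (Finset.measurable_fun_prod _ fun i _ => hm i) hW, hmap, lintegral_smul_measure, smul_eq_mul]
  have hind := lintegral_prod_eq_prod_lintegral_of_indepFun s (fun i (x : ι → ℝ) => g i (x i))
    (iIndepFun_pi (μ := ν) fun i => (hg i).aemeasurable) hm
  rw [hind]
  congr 1
  refine Finset.prod_congr rfl fun i _ => ?_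
  exact (measurePreserving_eval ν i).lintegral_comp (hg i)

/-- The Laplace transform of the exponential distribution. -/
lemma lintegral_exp_neg_expMeasure {r a : ℝ} (hr : 0 < r) (ha : 0 ≤ a) :
    ∫⁻ t, ENNReal.ofReal (Real.exp (-(a * t))) ∂expMeasure r = ENNReal.ofReal (r / (r + a)) := by
  have hra : 0 < r + a := by positivity
  have h1 : expMeasure r = volume.withDensity (exponentialPDF r) := rfl
  have hm (s : ℝ) : Measurable (exponentialPDF s) := (measurable_exponentialPDFReal s).ennreal_ofReal
  rw [h1, lintegral_withDensity_eq_lintegral_mul _ (hm r) (by fun_prop)]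
  have h2 : ∀ t, (exponentialPDF r * fun t => ENNReal.ofReal (Real.exp (-(a * t)))) t =
      ENNReal.ofReal (r / (r + a)) * exponentialPDF (r + a) t := fun t => by
    rw [Pi.mul_apply, exponentialPDF_eq, exponentialPDF_eq]
    split_ifs with ht
    · rw [← ENNReal.ofReal_mul (by positivity), ← ENNReal.ofReal_mul (by positivity)]
      congr 1
      rw [mul_assoc, ← Real.exp_add, ← mul_assoc, div_mul_cancel₀ _ hra.ne']
      congr 2
      ring
    · simp
  simp_rw [h2]
  rw [lintegral_const_mul _ (hm _), lintegral_exponentialPDF_eq_one hra, mul_one]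

lemma expMeasure_Iic_zero {r : ℝ} (hr : 0 < r) : expMeasure r (Set.Iic 0) = 0 := by
  have := isProbabilityMeasure_expMeasure hr
  have h := cdf_expMeasure_eq hr 0
  rw [cdf_eq_real] at h
  simpa [measureReal_eq_zero_iff] using h

namespace IsSkipFreeGenerator

variable {Q : Matrix ℕ ℕ ℝ}

lemma neg_diag_pos (hQ : IsSkipFreeGenerator Q) (i : ℕ) : 0 < -Q i i := by
  have h := hQ.row_sum i
  rw [Finset.sum_range_succ, Finset.sum_range_succ] at h
  have h1 : 0 ≤ ∑ j ∈ Finset.range i, Q i j :=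
    Finset.sum_nonneg fun j hj => hQ.nonneg i j (Finset.mem_range.1 hj).ne'
  have := hQ.up_pos i
  linarith

lemma isProbabilityMeasure_holding (hQ : IsSkipFreeGenerator Q) (i : ℕ) :
    IsProbabilityMeasure (expMeasure (-Q i i)) :=
  isProbabilityMeasure_expMeasure (hQ.neg_diag_pos i)

end IsSkipFreeGenerator

/-! ### Expectations along the jump chain with holding times. -/

section JumpChain

variable {Ω : Type*} [MeasurableSpace Ω] {P : Measure Ω} {Q : Matrix ℕ ℕ ℝ} {x₀ : ℕ}
  {Y : ℕ → Ω → ℕ} {W : ℕ → Ω → ℝ}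

/-- The joint law of the jump chain `Y` and the holding times `W`. -/
def HasJumpHoldLaw {Ω : Type*} [MeasurableSpace Ω] (P : Measure Ω) (Q : Matrix ℕ ℕ ℝ) (x₀ : ℕ)
    (Y : ℕ → Ω → ℕ) (W : ℕ → Ω → ℝ) : Prop :=
  ∀ (k : ℕ) (y : ℕ → ℕ) (B : ℕ → Set ℝ), (∀ i, MeasurableSet (B i)) →
    P {ω | ∀ i ≤ k, Y i ω = y i ∧ W i ω ∈ B i} =
      (if y 0 = x₀ then 1 else 0) *
        (∏ i ∈ Finset.range k, ENNReal.ofReal (jumpProb Q (y i) (y (i + 1)))) *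
        ∏ i ∈ Finset.range (k + 1), expMeasure (-Q (y i) (y i)) (B i)

lemma measurableSet_path (hY : ∀ k, Measurable (Y k)) (m : ℕ) (y : ℕ → ℕ) :
    MeasurableSet {ω | ∀ i ≤ m, Y i ω = y i} := by
  rw [Set.ofPred_forall]
  refine MeasurableSet.iInter fun i => ?_
  rw [Set.ofPred_forall]
  exact MeasurableSet.iInter fun _ => hY i (measurableSet_singleton _)

/-- Given the path, the holding times are independent, so the integral factorizes. Only the first
`m` of the `m + 1` visited states carry a weight, since the sojourn in the endpoint is not counted.
-/
lemma HasJumpHoldLaw.lintegral_path (hQ : IsSkipFreeGenerator Q)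
    (hlaw : HasJumpHoldLaw P Q x₀ Y W) (hY : ∀ k, Measurable (Y k)) (hW : ∀ k, Measurable (W k))
    {G : ℕ → ℝ → ℝ≥0∞} (hG : ∀ x, Measurable (G x)) (m : ℕ) (y : ℕ → ℕ) :
    ∫⁻ ω in {ω | ∀ i ≤ m, Y i ω = y i}, ∏ i ∈ Finset.range m, G (Y i ω) (W i ω) ∂P =
      (if y 0 = x₀ then 1 else 0) * ∏ i ∈ Finset.range m,
        (ENNReal.ofReal (jumpProb Q (y i) (y (i + 1))) *
          ∫⁻ t, G (y i) t ∂expMeasure (-Q (y i) (y i))) := by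
  have := fun x => hQ.isProbabilityMeasure_holding x
  have hA := measurableSet_path hY m y
  have h1 := lintegral_prod_eq_of_map_pi (μ := P.restrict {ω | ∀ i ≤ m, Y i ω = y i})
    (W := fun ω (i : Fin (m + 1)) => W i ω) (by fun_prop)
    (ν := fun i : Fin (m + 1) => expMeasure (-Q (y i) (y i)))
    (c := (if y 0 = x₀ then 1 else 0) *
        (∏ i ∈ Finset.range m, ENNReal.ofReal (jumpProb Q (y i) (y (i + 1)))))
    (ENNReal.mul_ne_top (by split_ifs <;> simp)
      (ENNReal.prod_ne_top fun i _ => ENNReal.ofReal_ne_top))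
    (fun B hB => by
      have := hlaw m y (fun i => if h : i < m + 1 then B ⟨i, h⟩ else Set.univ)
        (fun i => by split_ifs <;> simp [hB])
      rw [Finset.prod_range (fun i => expMeasure (-Q (y i) (y i)) _)] at this
      simp only [Fin.is_lt, dite_true, Fin.eta] at this
      rw [← this, Measure.restrict_apply']
      · congr 1
        ext ω
        simp only [Set.mem_inter_iff, Set.mem_ofPred_eq]
        constructor
        · rintro ⟨h, h'⟩ i hi
          rw [dif_pos (by omega)]
          exact ⟨h' i hi, h ⟨i, by omega⟩⟩
        · intro h
          refine ⟨fun i => ?_, fun i hi => (h i hi).1⟩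
          have := (h i (by omega)).2
          rwa [dif_pos i.2] at this
      · exact hA)
    (Finset.univ.map Fin.castSuccEmb) (g := fun i => G (y i)) (fun i => hG _)
  simp only [Finset.prod_map, Fin.coe_castSuccEmb, Fin.val_castSucc] at h1
  rw [← Finset.prod_range (fun i => ∫⁻ t, G (y i) t ∂expMeasure (-Q (y i) (y i)))] at h1
  rw [Finset.prod_mul_distrib, ← mul_assoc, ← h1]
  refine setLIntegral_congr_fun hA fun ω hω => ?_
  rw [Finset.prod_range]
  refine Finset.prod_congr rfl fun i _ => ?_
  rw [hω i (by omega)]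

/-- One step of the chain whose transition probabilities are weighted by the means of `G`. -/
noncomputable def weightedStep (Q : Matrix ℕ ℕ ℝ) (G : ℕ → ℝ → ℝ≥0∞) (f : ℕ → ℝ≥0∞) (x : ℕ) :
    ℝ≥0∞ :=
  ∑' z, (ENNReal.ofReal (jumpProb Q x z) * ∫⁻ t, G x t ∂expMeasure (-Q x x)) * f z

/-- Markov property at step `m`: split according to the path up to `m`, then according to the next
state. -/
lemma HasJumpHoldLaw.lintegral_succ (hQ : IsSkipFreeGenerator Q)
    (hlaw : HasJumpHoldLaw P Q x₀ Y W) (hY : ∀ k, Measurable (Y k)) (hW : ∀ k, Measurable (W k))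
    {G : ℕ → ℝ → ℝ≥0∞} (hG : ∀ x, Measurable (G x)) (m : ℕ) (f : ℕ → ℝ≥0∞) :
    ∫⁻ ω, f (Y (m + 1) ω) * ∏ i ∈ Finset.range (m + 1), G (Y i ω) (W i ω) ∂P =
      ∫⁻ ω, weightedStep Q G f (Y m ω) * ∏ i ∈ Finset.range m, G (Y i ω) (W i ω) ∂P := by
  have hGm (k : ℕ) : Measurable fun ω => G (Y k ω) (W k ω) :=
    (measurable_from_prod_countable_right hG : Measurable fun p : ℕ × ℝ => G p.1 p.2).comp
      ((hY k).prodMk (hW k))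
  have hprod (k : ℕ) : Measurable fun ω => ∏ i ∈ Finset.range k, G (Y i ω) (W i ω) :=
    Finset.measurable_fun_prod _ fun i _ => hGm i
  have hp : Measurable fun ω (i : Fin (m + 1)) => Y i ω := by fun_prop
  rw [lintegral_eq_tsum_fiber _ hp, lintegral_eq_tsum_fiber _ hp]
  refine tsum_congr fun y => ?_
  -- The value 0 beyond index `m` is never read.
  set y' : ℕ → ℕ := fun i => if h : i < m + 1 then y ⟨i, h⟩ else 0 with hy'
  have hset : (fun ω (i : Fin (m + 1)) => Y i ω) ⁻¹' {y} = {ω | ∀ i ≤ m, Y i ω = y' i} := by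
    ext ω
    simp only [Set.mem_preimage, Set.mem_singleton_iff, funext_iff, Set.mem_ofPred_eq, hy']
    constructor
    · intro h i hi
      rw [dif_pos (by omega)]
      exact h ⟨i, by omega⟩
    · intro h i
      have := h i (by omega)
      rwa [dif_pos i.2] at this
  rw [hset]
  have hA := measurableSet_path hY m y'
  have hR : ∫⁻ ω in {ω | ∀ i ≤ m, Y i ω = y' i},
      weightedStep Q G f (Y m ω) * ∏ i ∈ Finset.range m, G (Y i ω) (W i ω) ∂P =
      weightedStep Q G f (y' m) * ∫⁻ ω in {ω | ∀ i ≤ m, Y i ω = y' i},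
        ∏ i ∈ Finset.range m, G (Y i ω) (W i ω) ∂P := by
    rw [← lintegral_const_mul _ (hprod m)]
    exact setLIntegral_congr_fun hA fun ω hω => by simp only [hω m le_rfl]
  rw [hR, lintegral_eq_tsum_fiber _ (hY (m + 1)), weightedStep, ← ENNReal.tsum_mul_right]
  refine tsum_congr fun z => ?_
  set y'' := Function.update y' (m + 1) z with hy''
  have hyy (i : ℕ) (hi : i ≤ m) : y'' i = y' i := Function.update_of_ne (by omega) _ _
  have hyz : y'' (m + 1) = z := Function.update_self _ _ _
  have hset2 : Y (m + 1) ⁻¹' {z} ∩ {ω | ∀ i ≤ m, Y i ω = y' i} =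
      {ω | ∀ i ≤ m + 1, Y i ω = y'' i} := by
    ext ω
    simp only [Set.mem_inter_iff, Set.mem_preimage, Set.mem_singleton_iff, Set.mem_ofPred_eq]
    constructor
    · rintro ⟨h1, h2⟩ i hi
      rcases hi.lt_or_eq with h | rfl
      · rw [hyy i (by omega), h2 i (by omega)]
      · rw [hyz, h1]
    · intro h
      exact ⟨(h _ le_rfl).trans hyz, fun i hi => (h i (by omega)).trans (hyy i hi)⟩
  rw [Measure.restrict_restrict (hY (m + 1) (measurableSet_singleton z)), hset2]
  have hL : ∫⁻ ω in {ω | ∀ i ≤ m + 1, Y i ω = y'' i},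
      f (Y (m + 1) ω) * ∏ i ∈ Finset.range (m + 1), G (Y i ω) (W i ω) ∂P =
      f z * ∫⁻ ω in {ω | ∀ i ≤ m + 1, Y i ω = y'' i},
        ∏ i ∈ Finset.range (m + 1), G (Y i ω) (W i ω) ∂P := by
    rw [← lintegral_const_mul _ (hprod (m + 1))]
    exact setLIntegral_congr_fun (measurableSet_path hY _ _) fun ω hω => by
      simp only [hω (m + 1) le_rfl, hyz]
  rw [hL, hlaw.lintegral_path hQ hY hW hG, hlaw.lintegral_path hQ hY hW hG,
    Finset.prod_range_succ, hyz, hyy m le_rfl, hyy 0 (Nat.zero_le _)]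
  have : ∏ i ∈ Finset.range m, (ENNReal.ofReal (jumpProb Q (y'' i) (y'' (i + 1))) *
      ∫⁻ t, G (y'' i) t ∂expMeasure (-Q (y'' i) (y'' i))) =
      ∏ i ∈ Finset.range m, (ENNReal.ofReal (jumpProb Q (y' i) (y' (i + 1))) *
      ∫⁻ t, G (y' i) t ∂expMeasure (-Q (y' i) (y' i))) :=
    Finset.prod_congr rfl fun i hi => by
      rw [Finset.mem_range] at hi
      rw [hyy i (by omega), hyy (i + 1) (by omega)]
  rw [this]
  ring

lemma HasJumpHoldLaw.ae_start [IsProbabilityMeasure P] (hQ : IsSkipFreeGenerator Q)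
    (hlaw : HasJumpHoldLaw P Q x₀ Y W) (hY : ∀ k, Measurable (Y k)) : ∀ᵐ ω ∂P, Y 0 ω = x₀ := by
  have := fun x => hQ.isProbabilityMeasure_holding x
  have h := hlaw 0 (fun _ => x₀) (fun _ => Set.univ) fun _ => MeasurableSet.univ
  have h' : P (Y 0 ⁻¹' {x₀}) = 1 := by
    simp only [nonpos_iff_eq_zero, forall_eq, Set.mem_univ, and_true, if_true,
      Finset.range_zero, Finset.prod_empty, mul_one, zero_add, Finset.prod_range_one,
      measure_univ] at h
    exact h
  exact (mem_ae_iff_prob_eq_one (hY 0 (measurableSet_singleton x₀))).2 h'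

/-- The expectation of a weighted functional of the jump chain at step `m` is computed by iterating
`weightedStep`. -/
lemma HasJumpHoldLaw.lintegral_eq_iterate [IsProbabilityMeasure P] (hQ : IsSkipFreeGenerator Q)
    (hlaw : HasJumpHoldLaw P Q x₀ Y W) (hY : ∀ k, Measurable (Y k)) (hW : ∀ k, Measurable (W k))
    {G : ℕ → ℝ → ℝ≥0∞} (hG : ∀ x, Measurable (G x)) (m : ℕ) (f : ℕ → ℝ≥0∞) :
    ∫⁻ ω, f (Y m ω) * ∏ i ∈ Finset.range m, G (Y i ω) (W i ω) ∂P =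
      (weightedStep Q G)^[m] f x₀ := by
  induction m generalizing f with
  | zero =>
    have : ∫⁻ ω, f (Y 0 ω) ∂P = ∫⁻ _, f x₀ ∂P :=
      lintegral_congr_ae ((hlaw.ae_start hQ hY).mono fun ω h => by simp only [h])
    simpa using this
  | succ m ih => rw [hlaw.lintegral_succ hQ hY hW hG, ih, Function.iterate_succ_apply]

lemma HasJumpHoldLaw.ae_pos (hQ : IsSkipFreeGenerator Q)
    (hlaw : HasJumpHoldLaw P Q x₀ Y W) :
    ∀ᵐ ω ∂P, ∀ k, 0 < W k ω := by
  refine ae_all_iff.2 fun k => ?_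
  -- The law is only given along prescribed paths, so the bad event is covered by countably many of
  -- them.
  have hsub : {ω | ¬ 0 < W k ω} ⊆ ⋃ y : Fin (k + 1) → ℕ, {ω | ∀ i ≤ k,
      Y i ω = (fun i => if h : i < k + 1 then y ⟨i, h⟩ else 0) i ∧
        W i ω ∈ (fun i => if i = k then Set.Iic (0 : ℝ) else Set.univ) i} := by
    intro ω hω
    refine Set.mem_iUnion.2 ⟨fun i => Y i ω, fun i hi => ⟨?_, ?_⟩⟩
    · simp only
      rw [dif_pos (by omega)]
    · simp only
      split_ifs with h
      · subst h
        simpa using hω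
      · trivial
  refine measure_mono_null hsub (measure_iUnion_null fun y => ?_)
  rw [hlaw k _ _ fun i => by split_ifs <;> simp]
  refine mul_eq_zero_of_right _ (Finset.prod_eq_zero (Finset.mem_range.2 k.lt_succ_self) ?_)
  rw [if_pos rfl]
  exact expMeasure_Iic_zero (hQ.neg_diag_pos _)

end JumpChain

/-! ### The linear system for the Laplace transform -/

/-- The rate of going up from `x`. -/
def upRate (Q : Matrix ℕ ℕ ℝ) (x : ℕ) : ℝ := Q x (x + 1)

/-- The rate of going down by one from `x`. -/
def downRate (Q : Matrix ℕ ℕ ℝ) (x : ℕ) : ℝ := if x = 0 then 0 else Q x (x - 1)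

/-- The factor `e^{-a_x t}` collected during a visit of length `t` to `x < n`; paths are killed
outside `{0, …, n - 1}`. -/
noncomputable def killedWeight (n : ℕ) (a : ℕ → ℝ) (x : ℕ) (t : ℝ) : ℝ≥0∞ :=
  if x < n then ENNReal.ofReal (Real.exp (-(a x * t))) else 0

lemma measurable_killedWeight (n : ℕ) (a : ℕ → ℝ) (x : ℕ) : Measurable (killedWeight n a x) := by
  unfold killedWeight
  split_ifs <;> fun_prop

/-- The expectation of `exp (-∑ a_i l_{T_n}^i)` on `{T_n < ∞}` for the chain started at `x`. -/
noncomputable def hitTransform (Q : Matrix ℕ ℕ ℝ) (n : ℕ) (a : ℕ → ℝ) (x : ℕ) : ℝ≥0∞ :=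
  ∑' m, (weightedStep Q (killedWeight n a))^[m] (Pi.single n 1) x

section LinearSystem

variable {Q : Matrix ℕ ℕ ℝ} {n : ℕ} {a : ℕ → ℝ}

lemma IsSkipFreeGenerator.downRate_nonneg (hQ : IsSkipFreeGenerator Q) (x : ℕ) :
    0 ≤ downRate Q x := by
  unfold downRate
  split_ifs with h
  · exact le_rfl
  · exact hQ.nonneg _ _ (by omega)

lemma IsTridiagonal.apply_eq_zero (hn : IsTridiagonal (upperLeft Q n)) {x z : ℕ} (hx : x < n)
    (h : z + 1 < x) : Q x z = 0 :=
  hn ⟨x, hx⟩ ⟨z, by omega⟩ (Or.inr h)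

/-- Tridiagonality is needed only below the diagonal: the entry of row `n - 1` in column `n` lies
outside `Q_n`, and the row sum accounts for it. -/
lemma IsSkipFreeGenerator.neg_diag_eq (hQ : IsSkipFreeGenerator Q)
    (hn : IsTridiagonal (upperLeft Q n)) {x : ℕ} (hx : x < n) :
    -Q x x = upRate Q x + downRate Q x := by
  have h := hQ.row_sum x
  rw [Finset.sum_range_succ, Finset.sum_range_succ] at h
  have h1 : ∑ j ∈ Finset.range x, Q x j = downRate Q x := by
    rcases x with _ | x
    · simp [downRate]
    · rw [Finset.sum_range_succ, Finset.sum_eq_zero fun j hj =>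
        hn.apply_eq_zero hx (by rw [Finset.mem_range] at hj; omega)]
      simp [downRate]
  rw [h1] at h
  unfold upRate
  linarith

lemma weightedStep_of_le {x : ℕ} (hx : n ≤ x) (f : ℕ → ℝ≥0∞) :
    weightedStep Q (killedWeight n a) f x = 0 := by
  simp [weightedStep, killedWeight, hx.not_gt]

lemma weightedStep_of_lt (hQ : IsSkipFreeGenerator Q) (hn : IsTridiagonal (upperLeft Q n))
    {x : ℕ} (ha : 0 ≤ a x) (hx : x < n) (f : ℕ → ℝ≥0∞) :
    weightedStep Q (killedWeight n a) f x =
      ENNReal.ofReal (upRate Q x / (upRate Q x + downRate Q x + a x)) * f (x + 1) +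
      ENNReal.ofReal (downRate Q x / (upRate Q x + downRate Q x + a x)) * f (x - 1) := by
  have hb : 0 < upRate Q x := hQ.up_pos x
  have hd := hQ.downRate_nonneg x
  have hpos : 0 < upRate Q x + downRate Q x := by positivity
  have hI : ∫⁻ t, killedWeight n a x t ∂expMeasure (-Q x x) =
      ENNReal.ofReal ((upRate Q x + downRate Q x) / (upRate Q x + downRate Q x + a x)) := by
    simp only [killedWeight, if_pos hx]
    rw [hQ.neg_diag_eq hn hx, lintegral_exp_neg_expMeasure hpos ha]
  have hup : jumpProb Q x (x + 1) = upRate Q x / (upRate Q x + downRate Q x) := by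
    rw [jumpProb, if_neg (by omega), ← hQ.neg_diag_eq hn hx, neg_div, div_neg]; rfl
  -- At `x = 0` truncated subtraction gives `x - 1 = x`; both sides are then 0, so one formula
  -- covers the boundary.
  have hdown : jumpProb Q x (x - 1) = downRate Q x / (upRate Q x + downRate Q x) := by
    rcases x with _ | x
    · simp [jumpProb, downRate]
    · rw [jumpProb, if_neg (by omega), ← hQ.neg_diag_eq hn hx, neg_div, div_neg]
      simp [downRate]
  have hcancel (c : ℝ) (hc : 0 ≤ c) :
      ENNReal.ofReal (c / (upRate Q x + downRate Q x)) *
        ENNReal.ofReal ((upRate Q x + downRate Q x) / (upRate Q x + downRate Q x + a x)) =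
      ENNReal.ofReal (c / (upRate Q x + downRate Q x + a x)) := by
    rw [← ENNReal.ofReal_mul (by positivity)]
    congr 1
    field_simp
  rw [weightedStep, tsum_eq_sum (s := {x + 1, x - 1}), Finset.sum_pair (by omega), hI, hup, hdown,
    hcancel _ hb.le, hcancel _ hd]
  intro z hz
  simp only [Finset.mem_insert, Finset.mem_singleton, not_or] at hz
  have : jumpProb Q x z = 0 := by
    rw [jumpProb]
    split_ifs with h
    · rfl
    · rcases lt_or_gt_of_ne h with h | h
      · rw [hQ.skip_free x z (by omega)]; simp
      · rw [hn.apply_eq_zero hx (by omega)]; simp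
  simp [this]

/-- Killing at `n` leaves only the term with no steps. -/
lemma hitTransform_self : hitTransform Q n a n = 1 := by
  rw [hitTransform, tsum_eq_single 0]
  · simp
  · intro m hm
    obtain ⟨m, rfl⟩ := Nat.exists_eq_succ_of_ne_zero hm
    rw [Function.iterate_succ_apply', weightedStep_of_le le_rfl]

/-- First-step analysis: the term `m = 0` vanishes because `x ≠ n`, and the remaining series is one
weighted step applied to the whole series. -/
lemma hitTransform_of_lt (hQ : IsSkipFreeGenerator Q) (hn : IsTridiagonal (upperLeft Q n))
    {x : ℕ} (ha : 0 ≤ a x) (hx : x < n) :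
    hitTransform Q n a x =
      ENNReal.ofReal (upRate Q x / (upRate Q x + downRate Q x + a x)) *
        hitTransform Q n a (x + 1) +
      ENNReal.ofReal (downRate Q x / (upRate Q x + downRate Q x + a x)) *
        hitTransform Q n a (x - 1) := by
  rw [hitTransform, tsum_eq_zero_add' ENNReal.summable, hitTransform, hitTransform,
    ← ENNReal.tsum_mul_left, ← ENNReal.tsum_mul_left, ← ENNReal.tsum_add]
  simp only [Function.iterate_succ_apply', weightedStep_of_lt hQ hn ha hx,
    Function.iterate_zero, id_eq, Pi.single_eq_of_ne hx.ne, zero_add]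

/-- The two step weights add up to at most 1, so induction bounds every partial sum. The resulting
finiteness allows the linear system to be read in ℝ. -/
lemma hitTransform_le_one (hQ : IsSkipFreeGenerator Q) (hn : IsTridiagonal (upperLeft Q n))
    (ha : ∀ i, 0 ≤ a i) (x : ℕ) : hitTransform Q n a x ≤ 1 := by
  refine ENNReal.tsum_le_of_sum_range_le fun M => ?_
  induction M generalizing x with
  | zero => simp
  | succ M ih =>
    rw [Finset.sum_range_succ']
    simp only [Function.iterate_succ_apply']
    rcases lt_or_ge x n with hx | hx
    · have hb : 0 < upRate Q x := hQ.up_pos x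
      have hd := hQ.downRate_nonneg x
      have := ha x
      simp only [weightedStep_of_lt hQ hn (ha x) hx, Finset.sum_add_distrib, ← Finset.mul_sum,
        Function.iterate_zero, id_eq, Pi.single_eq_of_ne hx.ne, add_zero]
      calc _ ≤ ENNReal.ofReal (upRate Q x / (upRate Q x + downRate Q x + a x)) * 1 +
          ENNReal.ofReal (downRate Q x / (upRate Q x + downRate Q x + a x)) * 1 := by
            gcongr
            · exact ih _
            · exact ih _
        _ = ENNReal.ofReal ((upRate Q x + downRate Q x) /
              (upRate Q x + downRate Q x + a x)) := by
            rw [mul_one, mul_one, ← ENNReal.ofReal_add (by positivity) (by positivity), add_div]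
        _ ≤ 1 := by
            rw [ENNReal.ofReal_le_one, div_le_one (by positivity)]
            linarith
    · simp only [weightedStep_of_le hx, Finset.sum_const_zero, zero_add, Function.iterate_zero,
        id_eq]
      by_cases h : x = n
      · simp [h]
      · simp [Pi.single_eq_of_ne h]

lemma hitTransform_ne_top (hQ : IsSkipFreeGenerator Q) (hn : IsTridiagonal (upperLeft Q n))
    (ha : ∀ i, 0 ≤ a i) (x : ℕ) : hitTransform Q n a x ≠ ∞ :=
  ((hitTransform_le_one hQ hn ha x).trans_lt ENNReal.one_lt_top).ne

lemma hitTransform_toReal_eq (hQ : IsSkipFreeGenerator Q) (hn : IsTridiagonal (upperLeft Q n))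
    (ha : ∀ i, 0 ≤ a i) {x : ℕ} (hx : x < n) :
    (upRate Q x + downRate Q x + a x) * (hitTransform Q n a x).toReal =
      upRate Q x * (hitTransform Q n a (x + 1)).toReal +
      downRate Q x * (hitTransform Q n a (x - 1)).toReal := by
  have hb : 0 < upRate Q x := hQ.up_pos x
  have hd := hQ.downRate_nonneg x
  have := ha x
  rw [hitTransform_of_lt hQ hn (ha x) hx, ENNReal.toReal_add
    (ENNReal.mul_ne_top ENNReal.ofReal_ne_top (hitTransform_ne_top hQ hn ha _))
    (ENNReal.mul_ne_top ENNReal.ofReal_ne_top (hitTransform_ne_top hQ hn ha _)),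
    ENNReal.toReal_mul, ENNReal.toReal_mul, ENNReal.toReal_ofReal (by positivity),
    ENNReal.toReal_ofReal (by positivity)]
  field_simp

/-- The level `n` is hit almost surely. -/
lemma hitTransform_zero_eq_one (hQ : IsSkipFreeGenerator Q) (hn : IsTridiagonal (upperLeft Q n)) :
    hitTransform Q n 0 0 = 1 := by
  rcases n with _ | N
  · exact hitTransform_self
  have h := fun x (hx : x < N + 1) => hitTransform_toReal_eq (a := 0) hQ hn (fun _ => le_rfl) hx
  have h1 := h N (by omega)
  rw [hitTransform_self, ENNReal.toReal_one] at h1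
  simp only [Pi.zero_apply, add_zero] at h h1
  -- For zero exponents the constant 1 solves the same system.
  have key := tridiagonal_solution_unique (b := upRate Q) (d := downRate Q) (N := N)
    (A := fun x => upRate Q x + downRate Q x) (c := upRate Q N)
    (f := fun x => (hitTransform Q (N + 1) 0 x).toReal) (g := fun _ => 1)
    (hQ.up_pos N).ne' (fun i _ => (hQ.up_pos i).ne') (fun i hi => h i (by omega))
    (fun i _ => by ring) (by linarith) (by ring)
  rw [← ENNReal.ofReal_toReal (hitTransform_ne_top (a := 0) hQ hn (fun _ => le_rfl) 0), key,
    ENNReal.ofReal_one]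

end LinearSystem

/-! ### Occupation times in terms of the jump chain -/

section Path

variable {Ω : Type*} {X : ℝ≥0 → Ω → ℕ} {Y : ℕ → Ω → ℕ} {W : ℕ → Ω → ℝ} {n m : ℕ} {ω : Ω}

/-- The jump chain hits `n` at step `m`, having stayed strictly below `n` before. -/
def HitsAt (Y : ℕ → Ω → ℕ) (n m : ℕ) (ω : Ω) : Prop := (∀ i < m, Y i ω < n) ∧ Y m ω = n

lemma HitsAt.unique {m' : ℕ} (h : HitsAt Y n m ω) (h' : HitsAt Y n m' ω) : m = m' := by
  rcases lt_trichotomy m m' with hlt | rfl | hlt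
  · exact absurd h.2 (h'.1 m hlt).ne
  · rfl
  · exact absurd h'.2 (h.1 m' hlt).ne

open Classical in
/-- The time spent in state `i` during the visits made before the jump chain leaves
`{0, …, n - 1}`. -/
noncomputable def visitTime (Y : ℕ → Ω → ℕ) (W : ℕ → Ω → ℝ) (n i : ℕ) (ω : Ω) : ℝ≥0∞ :=
  ∑' j, if (∀ l < j + 1, Y l ω < n) ∧ Y j ω = i then ENNReal.ofReal (W j ω) else 0

lemma measurableSet_forall_lt [MeasurableSpace Ω] (hY : ∀ k, Measurable (Y k)) (n m : ℕ) :
    MeasurableSet {ω | ∀ i < m, Y i ω < n} := by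
  rw [Set.ofPred_forall]
  refine MeasurableSet.iInter fun i => ?_
  rw [Set.ofPred_forall]
  exact MeasurableSet.iInter fun _ => hY i measurableSet_Iio

lemma measurableSet_hitsAt [MeasurableSpace Ω] (hY : ∀ k, Measurable (Y k)) (n m : ℕ) :
    MeasurableSet {ω | HitsAt Y n m ω} :=
  (measurableSet_forall_lt hY n m).inter (hY m (measurableSet_singleton n))

lemma measurable_visitTime [MeasurableSpace Ω] (hY : ∀ k, Measurable (Y k))
    (hW : ∀ k, Measurable (W k)) (i : ℕ) : Measurable (visitTime Y W n i) :=
  Measurable.tsum fun j => Measurable.ite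
    ((measurableSet_forall_lt hY n (j + 1)).inter (hY j (measurableSet_singleton i)))
    (hW j).ennreal_ofReal measurable_const

/-- Once `n` is hit at step `m`, the condition of staying below `n` through step `j` means exactly
`j < m`. -/
lemma HitsAt.visitTime_eq_sum (h : HitsAt Y n m ω) (i : ℕ) :
    visitTime Y W n i ω =
      ∑ j ∈ Finset.range m, if Y j ω = i then ENNReal.ofReal (W j ω) else 0 := by
  rw [visitTime, tsum_eq_sum (s := Finset.range m)]
  · refine Finset.sum_congr rfl fun j hj => ?_
    rw [Finset.mem_range] at hj
    have : ∀ l < j + 1, Y l ω < n := fun l hl => h.1 l (by omega)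
    simp only [and_iff_right this]
  · intro j hj
    rw [Finset.mem_range, not_lt] at hj
    exact if_neg fun h' => (h'.1 m (by omega)).ne h.2

lemma HitsAt.visitTime_ne_top (h : HitsAt Y n m ω) (i : ℕ) : visitTime Y W n i ω ≠ ∞ := by
  rw [h.visitTime_eq_sum, ENNReal.sum_ne_top]
  intro j _
  split_ifs <;> simp

lemma HitsAt.sum_mul_visitTime (h : HitsAt Y n m ω) (hW : ∀ k, 0 < W k ω) (a : ℕ → ℝ) :
    ∑ x ∈ Finset.range n, a x * (visitTime Y W n x ω).toReal =
      ∑ j ∈ Finset.range m, a (Y j ω) * W j ω := by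
  have h1 (x : ℕ) : (visitTime Y W n x ω).toReal =
      ∑ j ∈ Finset.range m, if Y j ω = x then W j ω else 0 := by
    rw [h.visitTime_eq_sum, ENNReal.toReal_sum fun j _ => by split_ifs <;> simp]
    refine Finset.sum_congr rfl fun j _ => ?_
    split_ifs
    · exact ENNReal.toReal_ofReal (hW j).le
    · rfl
  simp_rw [h1, Finset.mul_sum]
  rw [Finset.sum_comm]
  refine Finset.sum_congr rfl fun j hj => ?_
  rw [Finset.mem_range] at hj
  simp only [mul_ite, mul_zero]
  rw [Finset.sum_ite_eq, if_pos (Finset.mem_range.2 (h.1 j hj))]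

lemma exists_holding_interval {w : ℕ → ℝ} {t : ℝ} (ht : 0 ≤ t) {m : ℕ}
    (h : t < ∑ i ∈ Finset.range m, w i) :
    ∃ k < m, ∑ i ∈ Finset.range k, w i ≤ t ∧ t < ∑ i ∈ Finset.range (k + 1), w i := by
  induction m with
  | zero => simp at h; linarith
  | succ m ih =>
    rcases lt_or_ge t (∑ i ∈ Finset.range m, w i) with h' | h'
    · obtain ⟨k, hk, hk'⟩ := ih h'
      exact ⟨k, by omega, hk'⟩
    · exact ⟨m, by omega, h', h⟩

/-- Any earlier time lies in one of the first `m` holding intervals, where the path is below `n`;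
positivity of `W m` makes the next interval contain its left endpoint, so the infimum is attained.
-/
lemma HitsAt.firstHit_eq (h : HitsAt Y n m ω) (hW : ∀ k, 0 < W k ω)
    (hX : ∀ (k : ℕ) (t : ℝ≥0), ∑ i ∈ Finset.range k, W i ω ≤ t →
      t < ∑ i ∈ Finset.range (k + 1), W i ω → X t ω = Y k ω) :
    firstHit X n ω = ENNReal.ofReal (∑ i ∈ Finset.range m, W i ω) := by
  have hS : 0 ≤ ∑ i ∈ Finset.range m, W i ω := Finset.sum_nonneg fun i _ => (hW i).le
  refine le_antisymm (iInf₂_le _ ?_) (le_iInf₂ fun t ht => ?_)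
  · rw [hX m _ (Real.coe_toNNReal _ hS).ge, h.2]
    rw [Real.coe_toNNReal _ hS, Finset.sum_range_succ]
    linarith [hW m]
  · rw [ENNReal.ofReal_le_iff_le_toReal ENNReal.coe_ne_top, ENNReal.coe_toReal]
    by_contra! hlt
    obtain ⟨k, hk, h1, h2⟩ := exists_holding_interval t.2 hlt
    exact (h.1 k hk).ne ((hX k t h1 h2).symm.trans ht)

lemma HitsAt.occupationTime_eq (h : HitsAt Y n m ω) (hW : ∀ k, 0 < W k ω)
    (hX : ∀ (k : ℕ) (t : ℝ≥0), ∑ i ∈ Finset.range k, W i ω ≤ t →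
      t < ∑ i ∈ Finset.range (k + 1), W i ω → X t ω = Y k ω) (i : ℕ) :
    occupationTime X n i ω = visitTime Y W n i ω := by
  have hset : {s : ℝ | 0 ≤ s ∧ ENNReal.ofReal s < firstHit X n ω} =
      Set.Ico 0 (∑ i ∈ Finset.range m, W i ω) := by
    ext s
    simp only [Set.mem_ofPred_eq, Set.mem_Ico, h.firstHit_eq hW hX]
    exact and_congr_right fun hs => ENNReal.ofReal_lt_ofReal_iff_of_nonneg hs
  have hS (k : ℕ) : 0 ≤ ∑ i ∈ Finset.range k, W i ω := Finset.sum_nonneg fun i _ => (hW i).le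
  have key (k : ℕ) : ∫⁻ s in Set.Ico 0 (∑ i ∈ Finset.range k, W i ω),
      {s : ℝ | X s.toNNReal ω = i}.indicator (1 : ℝ → ℝ≥0∞) s =
      ∑ j ∈ Finset.range k, if Y j ω = i then ENNReal.ofReal (W j ω) else 0 := by
    induction k with
    | zero => simp
    | succ k ih =>
      have hle : ∑ i ∈ Finset.range k, W i ω ≤ ∑ i ∈ Finset.range (k + 1), W i ω := by
        rw [Finset.sum_range_succ]
        linarith [hW k]
      have hlast : ∫⁻ s in Set.Ico (∑ i ∈ Finset.range k, W i ω)
          (∑ i ∈ Finset.range (k + 1), W i ω),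
          {s : ℝ | X s.toNNReal ω = i}.indicator (1 : ℝ → ℝ≥0∞) s =
          ∫⁻ _ in Set.Ico (∑ i ∈ Finset.range k, W i ω)
          (∑ i ∈ Finset.range (k + 1), W i ω), if Y k ω = i then 1 else 0 := by
        refine setLIntegral_congr_fun measurableSet_Ico fun s hs => ?_
        have hs0 : 0 ≤ s := (hS k).trans hs.1
        have := hX k s.toNNReal (by rw [Real.coe_toNNReal _ hs0]; exact hs.1)
          (by rw [Real.coe_toNNReal _ hs0]; exact hs.2)
        simp only [Set.indicator_apply, Set.mem_ofPred_eq, this, Pi.one_apply]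
      rw [← Set.Ico_union_Ico_eq_Ico (hS k) hle,
        lintegral_union measurableSet_Ico Set.Ico_disjoint_Ico_same, ih, hlast,
        Finset.sum_range_succ _ k, setLIntegral_const, Real.volume_Ico,
        Finset.sum_range_succ _ k, add_sub_cancel_left]
      congr 1
      split_ifs <;> simp
  rw [occupationTime, hset, key, h.visitTime_eq_sum]

end Path

/-! ### Joint Laplace transform of the occupation times. -/

section Law

variable {Ω : Type*} [MeasurableSpace Ω] {P : Measure Ω} [IsProbabilityMeasure P]
  {Q : Matrix ℕ ℕ ℝ} {Y : ℕ → Ω → ℕ} {W : ℕ → Ω → ℝ} {n : ℕ}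

lemma HasJumpHoldLaw.lintegral_tsum_eq_hitTransform (hQ : IsSkipFreeGenerator Q)
    (hlaw : HasJumpHoldLaw P Q 0 Y W) (hY : ∀ k, Measurable (Y k)) (hW : ∀ k, Measurable (W k))
    (a : ℕ → ℝ) :
    ∫⁻ ω, ∑' m, (Pi.single n 1 : ℕ → ℝ≥0∞) (Y m ω) *
      ∏ i ∈ Finset.range m, killedWeight n a (Y i ω) (W i ω) ∂P = hitTransform Q n a 0 := by
  have hG := measurable_killedWeight n a
  have hGm (k : ℕ) : Measurable fun ω => killedWeight n a (Y k ω) (W k ω) :=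
    (measurable_from_prod_countable_right hG :
      Measurable fun p : ℕ × ℝ => killedWeight n a p.1 p.2).comp ((hY k).prodMk (hW k))
  have hm (m : ℕ) : Measurable fun ω => (Pi.single n 1 : ℕ → ℝ≥0∞) (Y m ω) *
      ∏ i ∈ Finset.range m, killedWeight n a (Y i ω) (W i ω) :=
    ((measurable_of_countable (Pi.single n 1 : ℕ → ℝ≥0∞)).comp (hY m)).mul
      (Finset.measurable_fun_prod _ fun i _ => hGm i)
  rw [lintegral_tsum fun m => (hm m).aemeasurable]
  exact tsum_congr fun m => hlaw.lintegral_eq_iterate hQ hY hW hG m _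

lemma hitsAt_of_ne_zero {Ω : Type*} {Y : ℕ → Ω → ℕ} {W : ℕ → Ω → ℝ} {m : ℕ} {ω : Ω} {a : ℕ → ℝ}
    (h : (Pi.single n 1 : ℕ → ℝ≥0∞) (Y m ω) *
      ∏ i ∈ Finset.range m, killedWeight n a (Y i ω) (W i ω) ≠ 0) : HitsAt Y n m ω := by
  refine ⟨fun i hi => ?_, ?_⟩
  · by_contra hlt
    exact Finset.prod_ne_zero_iff.1 (right_ne_zero_of_mul h) i (Finset.mem_range.2 hi) (if_neg hlt)
  · by_contra h'
    exact left_ne_zero_of_mul h (Pi.single_eq_of_ne h' _)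

lemma HitsAt.tsum_killedWeight {Ω : Type*} {Y : ℕ → Ω → ℕ} {W : ℕ → Ω → ℝ} {m : ℕ} {ω : Ω}
    (h : HitsAt Y n m ω) (a : ℕ → ℝ) :
    ∑' m, (Pi.single n 1 : ℕ → ℝ≥0∞) (Y m ω) *
      ∏ i ∈ Finset.range m, killedWeight n a (Y i ω) (W i ω) =
      ENNReal.ofReal (Real.exp (-∑ j ∈ Finset.range m, a (Y j ω) * W j ω)) := by
  rw [tsum_eq_single m]
  · rw [h.2, Pi.single_eq_same, one_mul, ← Finset.sum_neg_distrib, Real.exp_sum,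
      ENNReal.ofReal_prod_of_nonneg fun _ _ => (Real.exp_pos _).le]
    exact Finset.prod_congr rfl fun i hi => if_pos (h.1 i (Finset.mem_range.1 hi))
  · intro m' hm'
    by_contra hne
    exact hm' ((hitsAt_of_ne_zero hne).unique h)

/-- With zero exponents the weighted sum is the indicator of hitting `n`, and its expectation is 1.
-/
lemma HasJumpHoldLaw.ae_exists_hitsAt (hQ : IsSkipFreeGenerator Q)
    (hn : IsTridiagonal (upperLeft Q n)) (hlaw : HasJumpHoldLaw P Q 0 Y W)
    (hY : ∀ k, Measurable (Y k)) (hW : ∀ k, Measurable (W k)) :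
    ∀ᵐ ω ∂P, ∃ m, HitsAt Y n m ω := by
  have h := hlaw.lintegral_tsum_eq_hitTransform (n := n) hQ hY hW 0
  rw [hitTransform_zero_eq_one hQ hn] at h
  have hE : MeasurableSet {ω | ∃ m, HitsAt Y n m ω} := by
    rw [Set.ofPred_exists]
    exact MeasurableSet.iUnion fun m => measurableSet_hitsAt hY n m
  refine (mem_ae_iff_prob_eq_one hE).2 ?_
  rw [← h, ← lintegral_indicator_one hE]
  refine lintegral_congr fun ω => ?_
  by_cases hω : ∃ m, HitsAt Y n m ω
  · rw [Set.indicator_of_mem (s := {ω | ∃ m, HitsAt Y n m ω}) hω]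
    obtain ⟨m, hm⟩ := hω
    rw [hm.tsum_killedWeight]
    simp
  · rw [Set.indicator_of_notMem (s := {ω | ∃ m, HitsAt Y n m ω}) hω]
    refine (ENNReal.tsum_eq_zero.2 fun m => ?_).symm
    by_contra hne
    exact hω ⟨m, hitsAt_of_ne_zero hne⟩

/-- The joint Laplace transform of the occupation times. -/
lemma HasJumpHoldLaw.lintegral_exp_visitTime (hQ : IsSkipFreeGenerator Q)
    (hn : IsTridiagonal (upperLeft Q n)) (hlaw : HasJumpHoldLaw P Q 0 Y W)
    (hY : ∀ k, Measurable (Y k)) (hW : ∀ k, Measurable (W k)) (a : ℕ → ℝ) :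
    ∫⁻ ω, ENNReal.ofReal
      (Real.exp (-∑ x ∈ Finset.range n, a x * (visitTime Y W n x ω).toReal)) ∂P =
      hitTransform Q n a 0 := by
  rw [← hlaw.lintegral_tsum_eq_hitTransform hQ hY hW a]
  refine lintegral_congr_ae ?_
  filter_upwards [hlaw.ae_exists_hitsAt hQ hn hY hW, hlaw.ae_pos hQ] with ω ⟨m, hm⟩ hpos
  rw [hm.tsum_killedWeight, hm.sum_mul_visitTime hpos]

end Law

/-! ### The conditional law of one occupation time given the previous ones. -/

lemma negExp_pow_eq {x : ℝ≥0∞} (hx : x ≠ ∞) (m : ℕ) :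
    negExp x ^ m = ENNReal.ofReal (Real.exp (-(m * x.toReal))) := by
  conv_lhs => rw [← ENNReal.ofReal_toReal hx]
  rw [negExp_ofReal ENNReal.toReal_nonneg, ← ENNReal.ofReal_pow (Real.exp_pos _).le,
    ← Real.exp_nat_mul, mul_neg]

lemma prod_negExp_pow_eq {k : ℕ} {l : ℕ → ℝ≥0∞} (hl : ∀ i, l i ≠ ∞) (m : Fin k → ℕ) {a : ℕ → ℝ}
    (ha : ∀ i : Fin k, a i = m i) :
    ∏ i : Fin k, negExp (l i) ^ m i =
      ENNReal.ofReal (Real.exp (-∑ x ∈ Finset.range k, a x * (l x).toReal)) := by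
  rw [← Finset.sum_neg_distrib, Real.exp_sum,
    ENNReal.ofReal_prod_of_nonneg fun _ _ => (Real.exp_pos _).le, Finset.prod_range]
  exact Finset.prod_congr rfl fun i _ => by rw [negExp_pow_eq (hl i), ha]

section Law

variable {Ω : Type*} [MeasurableSpace Ω] {P : Measure Ω} [IsProbabilityMeasure P]
  {Q : Matrix ℕ ℕ ℝ} {Y : ℕ → Ω → ℕ} {W : ℕ → Ω → ℝ} {n : ℕ}

lemma HasJumpHoldLaw.condDistrib_visitTime (hQ : IsSkipFreeGenerator Q)
    (hn : IsTridiagonal (upperLeft Q n)) (hlaw : HasJumpHoldLaw P Q 0 Y W)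
    (hY : ∀ k, Measurable (Y k)) (hW : ∀ k, Measurable (W k)) {N : ℕ} (hN : N + 1 < n) :
    ∀ᵐ ω ∂P, condDistrib (visitTime Y W n (N + 1))
        (fun ω' (j : Fin (N + 1)) => visitTime Y W n j ω') P
        (fun j : Fin (N + 1) => visitTime Y W n j ω) =
      condDistrib (visitTime Y W n (N + 1)) (visitTime Y W n N) P (visitTime Y W n N ω) := by
  have hm := measurable_visitTime (n := n) hY hW
  obtain ⟨γ, δ, hγδ, hred⟩ := exists_laplace_reduction (b := upRate Q) (d := downRate Q)
    hQ.up_pos hQ.downRate_nonneg hN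
  have hfin : ∀ᵐ ω ∂P, ∀ i, visitTime Y W n i ω ≠ ∞ := by
    filter_upwards [hlaw.ae_exists_hitsAt hQ hn hY hW] with ω ⟨m, h⟩ i
    exact h.visitTime_ne_top i
  refine condDistrib_ae_eq_condDistrib_comp (V := fun ω (j : Fin (N + 1)) => visitTime Y W n j ω)
    (by fun_prop) (hm (N + 1)) (Fin.last N)
    -- The conditional Laplace transform of the next occupation time, given that the current one is
    -- `x`.
    (ψ := fun r x => ENNReal.ofReal (δ r * Real.exp (-(γ r * x.toReal))))
    (fun r => by fun_prop) (fun r x => ?_) (fun r m => ?_)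
  · obtain ⟨h1, h2, h3⟩ := hγδ r r.cast_nonneg
    rw [ENNReal.ofReal_le_one]
    refine mul_le_one₀ h3 (Real.exp_pos _).le (Real.exp_le_one_iff.2 ?_)
    have := mul_nonneg h1 (ENNReal.toReal_nonneg (a := x))
    linarith
  obtain ⟨hγ, hδ, -⟩ := hγδ r r.cast_nonneg
  set a : ℕ → ℝ := fun i => if h : i < N + 1 then m ⟨i, h⟩ else if i = N + 1 then r else 0 with ha
  have ha_fin (i : Fin (N + 1)) : a i = m i := by simp only [ha, dif_pos i.2]
  have ha_last : a (N + 1) = r := by simp [ha]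
  have ha_gt (i : ℕ) (hi : N + 1 < i) : a i = 0 := by
    simp only [ha]
    rw [dif_neg (by omega), if_neg (by omega)]
  have ha_nonneg (i : ℕ) : 0 ≤ a i := by
    simp only [ha]
    split_ifs <;> positivity
  -- The exponent at level N + 1 is traded for an increment γ(r) at level N.
  set a' : ℕ → ℝ := fun i => if i < N then a i else if i = N then a N + γ (a (N + 1)) else 0
    with ha'
  have ha'_nonneg (i : ℕ) : 0 ≤ a' i := by
    simp only [ha', ha_last]
    have := ha_nonneg i
    have := ha_nonneg N
    split_ifs <;> positivity
  have hsum (c l : ℕ → ℝ) (hc : ∀ i, N + 1 < i → c i = 0) :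
      ∑ x ∈ Finset.range n, c x * l x =
        ∑ x ∈ Finset.range N, c x * l x + c N * l N + c (N + 1) * l (N + 1) := by
    rw [← Finset.sum_range_succ, ← Finset.sum_range_succ]
    refine (Finset.sum_subset (Finset.range_subset_range.2 (by omega)) fun x _ hx => ?_).symm
    rw [Finset.mem_range] at hx
    rw [hc x (by omega), zero_mul]
  have hL : ∫⁻ ω, negExp (visitTime Y W n (N + 1) ω) ^ r *
      ∏ i : Fin (N + 1), negExp (visitTime Y W n i ω) ^ m i ∂P = hitTransform Q n a 0 := by
    rw [← hlaw.lintegral_exp_visitTime hQ hn hY hW a]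
    refine lintegral_congr_ae (hfin.mono fun ω hω => ?_)
    simp only
    rw [prod_negExp_pow_eq hω m ha_fin, negExp_pow_eq (hω _),
      ← ENNReal.ofReal_mul (Real.exp_pos _).le, ← Real.exp_add,
      hsum a (fun x => (visitTime Y W n x ω).toReal) ha_gt, Finset.sum_range_succ, ha_last]
    congr 2
    ring
  have hR : ∫⁻ ω, ENNReal.ofReal
        (δ r * Real.exp (-(γ r * (visitTime Y W n (Fin.last N : Fin (N + 1)) ω).toReal))) *
      ∏ i : Fin (N + 1), negExp (visitTime Y W n i ω) ^ m i ∂P =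
      ENNReal.ofReal (δ r) * hitTransform Q n a' 0 := by
    rw [← hlaw.lintegral_exp_visitTime hQ hn hY hW a', ← lintegral_const_mul _ (by fun_prop)]
    refine lintegral_congr_ae (hfin.mono fun ω hω => ?_)
    simp only
    rw [prod_negExp_pow_eq hω m ha_fin, ENNReal.ofReal_mul hδ, mul_assoc,
      ← ENNReal.ofReal_mul (Real.exp_pos _).le, ← Real.exp_add,
      hsum a' (fun x => (visitTime Y W n x ω).toReal) (fun i hi => by
        simp only [ha']; rw [if_neg (by omega), if_neg (by omega)]), Finset.sum_range_succ]
    have h1 : ∑ x ∈ Finset.range N, a' x * (visitTime Y W n x ω).toReal =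
        ∑ x ∈ Finset.range N, a x * (visitTime Y W n x ω).toReal :=
      Finset.sum_congr rfl fun x hx => by simp only [ha']; rw [if_pos (Finset.mem_range.1 hx)]
    have h2 : a' N = a N + γ r := by simp [ha', ha_last]
    have h3 : a' (N + 1) = 0 := by simp [ha']
    rw [h1, h2, h3, Fin.val_last]
    congr 3
    ring
  have key := hred a (fun x => (hitTransform Q n a x).toReal)
    (fun x => (hitTransform Q n a' x).toReal) (ha_nonneg _) ha_gt
    (by simp [hitTransform_self]) (by simp [hitTransform_self])
    (fun i hi => hitTransform_toReal_eq hQ hn ha_nonneg hi)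
    (fun i hi => hitTransform_toReal_eq hQ hn ha'_nonneg hi)
  refine hL.trans (Eq.trans ?_ hR.symm)
  rw [← ENNReal.ofReal_toReal (hitTransform_ne_top hQ hn ha_nonneg 0), key, ha_last,
    ENNReal.ofReal_mul hδ, ENNReal.ofReal_toReal (hitTransform_ne_top hQ hn ha'_nonneg 0)]

end Law

theorem lemma1 {Ω : Type*} [MeasurableSpace Ω] (P : Measure Ω) [IsProbabilityMeasure P]
    (Q : Matrix ℕ ℕ ℝ) (hQ : IsSkipFreeGenerator Q)
    (X : ℝ≥0 → Ω → ℕ) (hX : IsMarkovJumpProcess P Q 0 X)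
    (n : ℕ) (hn : IsTridiagonal (upperLeft Q n)) :
    HasMarkovProperty P n (fun i => occupationTime X n i) := by
  obtain ⟨-, Y, W, hY, hW, hlaw, hXY⟩ := hX
  replace hlaw : HasJumpHoldLaw P Q 0 Y W := hlaw
  have hocc : ∀ᵐ ω ∂P, ∀ i, occupationTime X n i ω = visitTime Y W n i ω := by
    filter_upwards [hlaw.ae_exists_hitsAt hQ hn hY hW, hlaw.ae_pos hQ, hXY] with ω ⟨m, hm⟩ hpos h i
    exact hm.occupationTime_eq hpos h i
  have hocc' (i : ℕ) : occupationTime X n i =ᵐ[P] visitTime Y W n i := hocc.mono fun ω h => h i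
  -- The visit times serve as measurable versions of the occupation times.
  refine ⟨fun i _ => ⟨_, measurable_visitTime hY hW i, hocc' i⟩, fun k hk1 hkn => ?_⟩
  obtain ⟨N, rfl⟩ : ∃ N, k = N + 1 := ⟨k - 1, by omega⟩
  simp only [Nat.add_sub_cancel]
  rw [condDistrib_congr (hocc' (N + 1)) (X' := fun ω (j : Fin (N + 1)) => visitTime Y W n j ω)
    (hocc.mono fun ω h => funext fun j => h j), condDistrib_congr (hocc' (N + 1)) (hocc' N)]
  filter_upwards [hlaw.condDistrib_visitTime hQ hn hY hW hkn, hocc] with ω h h'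
  simp only [h']
  exact h
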